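/- **Setting.** Let $X$, $Y$ be real Banach spaces and let $1<p,q<\infty$ with $\frac1p+\frac1q=1$; assume that $X$ is convex of power type $p$ and smooth of power type $q$. Write $J_p:X\to X^*$ for the (single-valued) duality mapping of $X$ with gauge $t\mapsto t^{p-1}$, $J_q^*:X^*\to X$ for that of $X^*$ with gauge $t\mapsto t^{q-1}$ (where $X^{**}=X$), $j_p$ for a fixed single-valued selection of the duality mapping of $Y$ with gauge $t\mapsto t^{p-1}$, and $$\Delta_p(x,\tilde x)=\tfrac1p\|\tilde x\|^p-\tfrac1p\|x\|^p-\langle J_p(x),\tilde x-x\rangle$$ for the Bregman distance; $\Delta_q$ is the analogous distance on $X^*$. Let $C_p,G_q>0$ be constants with $\Delta_p(x,\tilde x)\ge\frac{C_p}{p}\|x-\tilde x\|^p$ on $X$ and $\Delta_q(x^*,\tilde x^*)\le\frac{G_q}{q}\|x^*-\tilde x^*\|^q$ on $X^*$. For a nonempty closed convex $Z\subset X$ let $P_Z(x)=\arg\min\{\Delta_p(x,w)\mid w\in Z\}$. **Levels.** Let $N\ge 0$ be an integer, $y\in Y$, $\varepsilon>0$, $\hat\eta\in\mathbb R$. For $n=0,\dots,N$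 let $Z_n\subset X$ be closed and convex, $F_n:Z_n\to Y$, $\eta_n=\operatorname{dist}(y,F_n(Z_n))$, and let $z_n^\dagger\in Z_n$ satisfy $\|F_n(z_n^\dagger)-y\|=\eta_n$. Let $\hat{\mathfrak L}_n,\mathfrak L_n,\mathfrak C_n>0$ and put $$\tilde{\mathfrak C}_n=\tfrac12\left(\tfrac{C_p}{p}\right)^{-2/p}\mathfrak L_n\mathfrak C_n^2,\qquad S_n=\frac{1+\sqrt{1-8\tilde{\mathfrak C}_n\eta_n}}{2\tilde{\mathfrak C}_n}-2\eta_n,\qquad \rho_n=\tfrac{C_p}{p}\,\hat{\mathfrak L}_n^{-p}S_n^{\,p},$$ where it is assumed that $8\tilde{\mathfrak C}_n\eta_n\le1$ for $n\le N$, and that $\eta_N>0$. Let $\mathcal B\subset X$ be a set that contains $\{x\in Z_n\mid\Delta_p(x,z_n^\dagger)\le\rho_n\}$ for every $n\le N$, and assume that for every $n\le N$: * $F_n$ has at each $x\in\mathcal B\cap Z_n$ a Fréchet derivative $DF_n(x)\in\mathcal L(X,Y)$ (relative to $Z_n$), with $\|DF_n(x)\|\le\hat{\mathfrak L}_n$ and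 $\|DF_n(x)-DF_n(\tilde x)\|\le\mathfrak L_n\|x-\tilde x\|$ for $x,\tilde x\in\mathcal B\cap Z_n$; * $\Delta_p(x,\tilde x)\le\mathfrak C_n^p\|F_n(x)-F_n(\tilde x)\|^p$ for $x,\tilde x\in\mathcal B\cap Z_n$. Assume that for $n<N$: $Z_n\subset Z_{n+1}$, $\mathfrak C_n\le\mathfrak C_{n+1}$, $\eta_{n+1}\le\eta_n$, and $\|F_{n+1}(x)-y\|\le\|F_n(x)-y\|$ for $x\in\mathcal B\cap Z_n$ (the last condition is automatic, with equality, if $F_n=F|_{Z_n}$ for a single operator $F$). **Algorithm 1 on level $n$.** Start from $x_{n,0}\in Z_n$ with $\Delta_p(x_{n,0},z_n^\dagger)<\rho_n$, and iterate $$x_{n,k+1}=P_{Z_n}\bigl(J_q^*(J_p(x_{n,k})-\mu_kT_k)\bigr),$$ where $T_k=DF_n(x_{n,k})^*j_p(F_n(x_{n,k})-y)$, $r_k=\|F_n(x_{n,k})-y\|$, $\hat t_k=G_q\|T_k\|^q$, $u_k=-\tilde{\mathfrak C}_nr_k^2+(1-2\tilde{\mathfrak C}_n\eta_n)r_k-\eta_n-\tilde{\mathfrak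 C}_n\eta_n^2$ and $\mu_k=\hat t_k^{-1/(q-1)}u_k^{1/(q-1)}r_k^{(p-1)/(q-1)}$; stop at the first index $K_n$ with $\|F_n(x_{n,K_n})-y\|\le(3+\varepsilon)\eta_n$. **Algorithm 2.** Start from $x_{0,0}$; run Algorithm 1 successively on the levels $n=0,1,\dots,N$ with $x_{n+1,0}=x_{n,K_n}$, and stop after level $N$. **Theorem.** Assume moreover that (a) $x_{0,0}\in Z_0$ and $\Delta_p(x_{0,0},z_0^\dagger)<\rho_0$; (b) for $n=0,\dots,N-1$, $$(3+\varepsilon)\eta_n<\left(\tfrac{C_p}{p}\right)^{1/p}(\hat{\mathfrak L}_{n+1}\mathfrak C_{n+1})^{-1}\left(\frac{1+\sqrt{1-8\tilde{\mathfrak C}_{n+1}\eta_{n+1}}}{2\tilde{\mathfrak C}_{n+1}}-2\eta_{n+1}\right)-\eta_{n+1};$$ (c) $(3+\varepsilon)\eta_n>\hat\eta$ for all $n<N$, and $(3+\varepsilon)\eta_N\le\hat\eta$. Then Algorithm 2 can be carried out and terminates after finitely many iterations: on every level $n\le N$ the starting point $x_{n,0}$ is admissible for Algorithm 1 (that is,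 $x_{n,0}\in Z_n$ and $\Delta_p(x_{n,0},z_n^\dagger)<\rho_n$) and the stopping index $K_n$ is finite; and the final iterate satisfies $\|F_N(x_{N,K_N})-y\|\le\hat\eta$. -/

import Mathlib

noncomputable section

namespace MultiLevel

section Geometry

variable {E : Type*} [NormedAddCommGroup E] [NormedSpace ℝ E]

/-- The convexity modulus `δ_E(ε)`. It is `EReal`-valued, so that the infimum over the empty
set is `+∞`. -/
def convexityModulus (E : Type*) [NormedAddCommGroup E] [NormedSpace ℝ E] (ε : ℝ) : EReal :=
  ⨅ (x : E) (x' : E) (_ : ‖x‖ = 1 ∧ ‖x'‖ = 1 ∧ ε ≤ ‖x - x'‖),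
    ((1 - ‖(1 / 2 : ℝ) • (x + x')‖ : ℝ) : EReal)

/-- The smoothness modulus `ρ_E(τ)`. -/
def smoothnessModulus (E : Type*) [NormedAddCommGroup E] [NormedSpace ℝ E] (τ : ℝ) : EReal :=
  ⨆ (x : E) (x' : E) (_ : ‖x‖ = 1 ∧ ‖x'‖ = 1),
    ((1 / 2 * (‖x + τ • x'‖ + ‖x - τ • x'‖ - 2) : ℝ) : EReal)

/-- `E` is convex of power type `p`. -/
def IsPConvex (E : Type*) [NormedAddCommGroup E] [NormedSpace ℝ E] (p : ℝ) : Prop :=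
  ∃ C : ℝ, 0 < C ∧ ∀ ε ∈ Set.Icc (0 : ℝ) 2, ((C * ε ^ p : ℝ) : EReal) ≤ convexityModulus E ε

/-- `E` is smooth of power type `q`. -/
def IsQSmooth (E : Type*) [NormedAddCommGroup E] [NormedSpace ℝ E] (q : ℝ) : Prop :=
  ∃ C : ℝ, 0 < C ∧ ∀ τ : ℝ, 0 < τ → smoothnessModulus E τ ≤ ((C * τ ^ q : ℝ) : EReal)

/-- The set-valued duality mapping of `E` with gauge function `t ↦ t ^ (p - 1)`. -/
def dualitySet (p : ℝ) (x : E) : Set (StrongDual ℝ E) :=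
  {f | f x = ‖x‖ * ‖f‖ ∧ ‖f‖ = ‖x‖ ^ (p - 1)}

/-- The duality mapping `J_p` as a function: the element of `dualitySet p x`
(which is unique when `E` is uniformly smooth). -/
def dualityMap (p : ℝ) (x : E) : StrongDual ℝ E :=
  Classical.epsilon fun f => f ∈ dualitySet p x

/-- The duality mapping `J_q^*` of the dual space with gauge function `t ↦ t ^ (q - 1)`, with
values in `E` through the canonical embedding of `E` in its bidual (onto, as the spaces
considered below are reflexive). -/
def dualityMapStar (q : ℝ) (f : StrongDual ℝ E) : E :=
  Classical.epsilon fun x => NormedSpace.inclusionInDoubleDual ℝ E x ∈ dualitySet q f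

/-- The Bregman distance `Δ_p(x, x')` of the functional `x ↦ ‖x‖ ^ p / p`. -/
def bregman (p : ℝ) (x x' : E) : ℝ :=
  1 / p * ‖x'‖ ^ p - 1 / p * ‖x‖ ^ p - dualityMap p x (x' - x)

/-- The Bregman projection of `x` onto `Z`: the minimizer of `Δ_p(x, ·)` over `Z`. -/
def bregmanProj (p : ℝ) (Z : Set E) (x : E) : E :=
  Classical.epsilon fun z => z ∈ Z ∧ ∀ w ∈ Z, bregman p x z ≤ bregman p x w

/-- `Cp` is a constant in the lower bound of the Bregman distance of a `p`-convex space. -/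
def IsConvexityConst (E : Type*) [NormedAddCommGroup E] [NormedSpace ℝ E] (p Cp : ℝ) : Prop :=
  0 < Cp ∧ ∀ x x' : E, Cp / p * ‖x - x'‖ ^ p ≤ bregman p x x'

/-- `Gq` is a constant in the upper bound of the Bregman distance of the `q`-smooth space
`E^*`. -/
def IsDualSmoothnessConst (E : Type*) [NormedAddCommGroup E] [NormedSpace ℝ E]
    (q Gq : ℝ) : Prop :=
  0 < Gq ∧ ∀ f f' : StrongDual ℝ E, bregman q f f' ≤ Gq / q * ‖f - f'‖ ^ q

end Geometry

/-- The data of one level: the constraint set `Z`, the operator `F` (only its values on `Z`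
matter), its derivative `DF`, and the constants `L̂` (bound on `DF`), `L` (Lipschitz constant
of `DF`) and `C` (stability constant). -/
structure Level (X Y : Type*) [NormedAddCommGroup X] [NormedSpace ℝ X]
    [NormedAddCommGroup Y] [NormedSpace ℝ Y] where
  Z : Set X
  F : X → Y
  DF : X → X →L[ℝ] Y
  Lhat : ℝ
  L : ℝ
  C : ℝ

namespace Level

variable {X Y : Type*} [NormedAddCommGroup X] [NormedSpace ℝ X]
  [NormedAddCommGroup Y] [NormedSpace ℝ Y]

/-- The approximation error `dist(y, F(Z))`. -/
def eta (l : Level X Y) (y : Y) : ℝ := Metric.infDist y (l.F '' l.Z)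

/-- The constant `(1/2) (C_p/p)^(-2/p) L C²`. -/
def Ctilde (l : Level X Y) (p Cp : ℝ) : ℝ :=
  1 / 2 * (Cp / p) ^ (-2 / p) * l.L * l.C ^ 2

/-- The length `(1 + √(1 - 8 C̃ η)) / (2 C̃) - 2 η` that enters the convergence radius. -/
def radiusBase (l : Level X Y) (p Cp : ℝ) (y : Y) : ℝ :=
  (1 + √(1 - 8 * l.Ctilde p Cp * l.eta y)) / (2 * l.Ctilde p Cp) - 2 * l.eta y

/-- The convergence radius of the level. -/
def radius (l : Level X Y) (p Cp : ℝ) (y : Y) : ℝ :=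
  Cp / p * l.Lhat ^ (-p) * l.radiusBase p Cp y ^ p

/-- `z` is a best approximating solution in `Z`. -/
def IsBestApprox (l : Level X Y) (y : Y) (z : X) : Prop :=
  z ∈ l.Z ∧ ‖l.F z - y‖ = l.eta y

/-- The standing assumptions on one level, on the part of `Z` in the set `B`. The derivative
is that of `F` restricted to `Z`. -/
structure Regular (l : Level X Y) (p : ℝ) (B : Set X) : Prop where
  isClosed : IsClosed l.Z
  convex : Convex ℝ l.Z
  Lhat_pos : 0 < l.Lhat
  L_pos : 0 < l.L
  C_pos : 0 < l.C
  hasDeriv : ∀ x ∈ B ∩ l.Z, HasFDerivWithinAt l.F (l.DF x) l.Z x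
  deriv_bound : ∀ x ∈ B ∩ l.Z, ‖l.DF x‖ ≤ l.Lhat
  deriv_lipschitz : ∀ x ∈ B ∩ l.Z, ∀ x' ∈ B ∩ l.Z, ‖l.DF x - l.DF x'‖ ≤ l.L * ‖x - x'‖
  stability : ∀ x ∈ B ∩ l.Z, ∀ x' ∈ B ∩ l.Z, bregman p x x' ≤ l.C ^ p * ‖l.F x - l.F x'‖ ^ p

/-- The descent direction `T = DF(x)^* j_p(F(x) - y)`. -/
def descentDir (l : Level X Y) (j : Y → StrongDual ℝ Y) (y : Y) (x : X) : StrongDual ℝ X :=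
  (j (l.F x - y)).comp (l.DF x)

/-- The step size `μ = t̂^(-1/(q-1)) u^(1/(q-1)) r^((p-1)/(q-1))`. -/
def stepSize (l : Level X Y) (p q Cp Gq : ℝ) (j : Y → StrongDual ℝ Y) (y : Y) (x : X) : ℝ :=
  let r := ‖l.F x - y‖
  let that := Gq * ‖l.descentDir j y x‖ ^ q
  let η := l.eta y
  let c := l.Ctilde p Cp
  let u := -c * r ^ 2 + (1 - 2 * c * η) * r - η - c * η ^ 2
  that ^ (-1 / (q - 1)) * u ^ (1 / (q - 1)) * r ^ ((p - 1) / (q - 1))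

/-- One step of the projected steepest descent iteration. -/
def step (l : Level X Y) (p q Cp Gq : ℝ) (j : Y → StrongDual ℝ Y) (y : Y) (x : X) : X :=
  bregmanProj p l.Z
    (dualityMapStar q (dualityMap p x - l.stepSize p q Cp Gq j y x • l.descentDir j y x))

/-- `x 0, …, x K` is a run of the projected steepest descent algorithm on one level (the values
`x k`, `k > K`, are irrelevant): it starts at a point of `Z` within the convergence radius around
`z`, each iterate is obtained from the preceding one by the descent step, and `K` is the first
index at which the discrepancy is at most `tol`. -/
structure IsRun (l : Level X Y) (p q Cp Gq : ℝ) (j : Y → StrongDual ℝ Y) (y : Y) (z : X)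
    (tol : ℝ) (x : ℕ → X) (K : ℕ) : Prop where
  start_mem : x 0 ∈ l.Z
  start_radius : bregman p (x 0) z < l.radius p Cp y
  step_eq : ∀ k < K, x (k + 1) = l.step p q Cp Gq j y (x k)
  isLeast_index : IsLeast {k | ‖l.F (x k) - y‖ ≤ tol} K

end Level

/-- `x n k` (`n ≤ N`, `k ≤ K n`) is a complete, terminating run of the multi-level algorithm
started at `x₀`: on each level `n ≤ N` the projected steepest descent algorithm is run until the
discrepancy is at most `(3 + ε) η_n`, and its result is the starting point of the next level. -/
structure IsMultiLevelRun {X Y : Type*} [NormedAddCommGroup X] [NormedSpace ℝ X]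
    [NormedAddCommGroup Y] [NormedSpace ℝ Y] (l : ℕ → Level X Y) (p q Cp Gq : ℝ)
    (j : Y → StrongDual ℝ Y) (y : Y) (z : ℕ → X) (ε : ℝ) (N : ℕ) (x₀ : X)
    (x : ℕ → ℕ → X) (K : ℕ → ℕ) : Prop where
  start : x 0 0 = x₀
  level_run : ∀ n ≤ N,
    (l n).IsRun p q Cp Gq j y (z n) ((3 + ε) * (l n).eta y) (x n) (K n)
  next_start : ∀ n < N, x (n + 1) 0 = x n (K n)

end MultiLevel

end

noncomputable section

namespace MultiLevel

open Filter Topology Asymptotics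

/-! ### Duality mappings and Bregman distances. -/

section Geometry

variable {E : Type*} [NormedAddCommGroup E] [NormedSpace ℝ E]

/-! On one level, every step lowers the Bregman distance to the best approximation `z` by at least a
fixed `κ > 0` while the discrepancy `r` exceeds `(3 + ε) η`. That distance is nonnegative, so the
level ends after finitely many steps (`exists_step_decrease`, `exists_isRun`). The decrease has two
sources. Geometrically, a step `μ T` in the dual space raises the distance by at most `Gq / q * ‖μ
T‖ ^ q + μ T (z - x)`, and the projection does not increase it (`bregman_dual_step_le`,
`bregman_bregmanProj_le`). Analytically, Taylor's formula and the stability estimate give `T (z - x)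
≤ -u r ^ (p - 1)` with `u` quadratic in `r` (`descentDir_apply_le`). The convergence radius and the
stopping threshold keep `r` strictly between the roots of `u` (`quadratic_lower_bound`), and `μ`
minimises the resulting bound.

Between levels, the final discrepancy on level `n` bounds the one on level `n + 1`, and stability
there turns it into a Bregman distance. The coupling condition is what puts this distance below the
next radius (`bregman_lt_radius`). -/

lemma isLittleO_norm_rpow {E : Type*} [NormedAddCommGroup E] {r : ℝ} (hr : 1 < r) :
    (fun h : E => ‖h‖ ^ r) =o[𝓝 0] fun h : E => h := by
  rw [← isLittleO_norm_right]
  refine isLittleO_of_tendsto (fun x hx => ?_) ?_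
  · rw [hx, Real.zero_rpow (by linarith)]
  · have h1 : Tendsto (fun h : E => ‖h‖ ^ (r - 1)) (𝓝 0) (𝓝 0) := by
      have h2 : ContinuousAt (fun h : E => ‖h‖ ^ (r - 1)) 0 :=
        continuous_norm.continuousAt.rpow_const (Or.inr (by linarith))
      simpa [ContinuousAt, Real.zero_rpow (sub_pos.2 hr).ne'] using h2
    refine h1.congr fun h => ?_
    rcases eq_or_ne h 0 with rfl | hh
    · simp [Real.zero_rpow (sub_pos.2 hr).ne']
    · rw [Real.rpow_sub_one (norm_ne_zero_iff.2 hh)]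

/-- A continuous linear functional bounded above by a superlinear power of the norm vanishes. -/
lemma eq_zero_of_le_rpow {L : StrongDual ℝ E} {c r : ℝ} (hr : 1 < r)
    (h : ∀ v, L v ≤ c * ‖v‖ ^ r) : L = 0 := by
  -- The bounds at `v` and `-v` make `L` a derivative of the zero function at `0`; uniqueness of
  -- derivatives then gives `L = 0`.
  have hL : HasFDerivAt (fun _ : E => (0 : ℝ)) L 0 := by
    rw [hasFDerivAt_iff_isLittleO_nhds_zero]
    refine IsBigO.trans_isLittleO (IsBigO.of_bound c (Eventually.of_forall fun v => ?_))
      (isLittleO_norm_rpow hr)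
    have h1 := h v
    have h2 := h (-v)
    rw [map_neg, norm_neg] at h2
    rw [Real.norm_of_nonneg (Real.rpow_nonneg (norm_nonneg v) r), Real.norm_eq_abs, abs_le]
    constructor <;> simp <;> linarith
  exact hL.unique (hasFDerivAt_const 0 0)

lemma exists_mem_dualitySet {p : ℝ} (hp : 1 < p) (x : E) : (dualitySet p x).Nonempty := by
  rcases eq_or_ne x 0 with rfl | hx
  · exact ⟨0, by simp [dualitySet, Real.zero_rpow (sub_pos.2 hp).ne']⟩
  · obtain ⟨g, hg, hgx⟩ := exists_dual_vector ℝ x (norm_ne_zero_iff.2 hx)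
    have hn : 0 ≤ ‖x‖ ^ (p - 1) := Real.rpow_nonneg (norm_nonneg x) _
    refine ⟨‖x‖ ^ (p - 1) • g, ?_, ?_⟩
    · simp [norm_smul, hg, hgx, abs_of_nonneg hn, mul_comm]
    · simp [norm_smul, hg, abs_of_nonneg hn]

lemma dualityMap_mem {p : ℝ} (hp : 1 < p) (x : E) : dualityMap p x ∈ dualitySet p x :=
  Classical.epsilon_spec (exists_mem_dualitySet hp x)

lemma apply_self_of_mem_dualitySet {p : ℝ} (hp : 1 < p) {x : E} {f : StrongDual ℝ E}
    (hf : f ∈ dualitySet p x) : f x = ‖x‖ ^ p := by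
  rw [hf.1, hf.2]
  rcases eq_or_ne x 0 with rfl | hx
  · simp [Real.zero_rpow (by linarith : p ≠ 0)]
  · rw [Real.rpow_sub_one (norm_ne_zero_iff.2 hx)]
    field_simp [norm_ne_zero_iff.2 hx]

lemma norm_rpow_of_mem_dualitySet {p q : ℝ} (hpq : p.HolderConjugate q) {x : E}
    {f : StrongDual ℝ E} (hf : f ∈ dualitySet p x) : ‖f‖ ^ q = ‖x‖ ^ p := by
  rw [hf.2, ← Real.rpow_mul (norm_nonneg x), hpq.sub_one_mul_conj]

lemma apply_le_young {p q : ℝ} (hpq : p.HolderConjugate q) (f : StrongDual ℝ E) (x : E) :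
    f x ≤ 1 / p * ‖x‖ ^ p + 1 / q * ‖f‖ ^ q := by
  have h1 : f x ≤ ‖f‖ * ‖x‖ := (le_abs_self _).trans (f.le_opNorm x)
  have h2 := Real.young_inequality_of_nonneg (norm_nonneg x) (norm_nonneg f) hpq
  rw [one_div_mul_eq_div, one_div_mul_eq_div]
  linarith

lemma apply_eq_young {p q : ℝ} (hpq : p.HolderConjugate q) {x : E} {f : StrongDual ℝ E}
    (hf : f ∈ dualitySet p x) : f x = 1 / p * ‖x‖ ^ p + 1 / q * ‖f‖ ^ q := by
  rw [apply_self_of_mem_dualitySet hpq.lt hf, norm_rpow_of_mem_dualitySet hpq hf, ← add_mul,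
    hpq.one_div_add_one_div, div_one, one_mul]

/-- Elements of the duality set are subgradients of `‖·‖ ^ p / p`. -/
lemma subgradient_of_mem_dualitySet {p q : ℝ} (hpq : p.HolderConjugate q) {x : E}
    {f : StrongDual ℝ E} (hf : f ∈ dualitySet p x) (v : E) :
    1 / p * ‖x‖ ^ p + f (v - x) ≤ 1 / p * ‖v‖ ^ p := by
  have h1 := apply_le_young hpq f v
  have h2 := apply_eq_young hpq hf
  rw [map_sub]
  linarith

/-- Equality in Young's inequality eliminates `x` in favour of `dualityMap p x`, the quantity that a
step in the dual space controls. -/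
lemma bregman_eq_conj {p q : ℝ} (hpq : p.HolderConjugate q) (x v : E) :
    bregman p x v = 1 / p * ‖v‖ ^ p + 1 / q * ‖dualityMap p x‖ ^ q - dualityMap p x v := by
  have h := apply_eq_young hpq (dualityMap_mem hpq.lt x)
  rw [bregman, map_sub]
  linarith

lemma bregman_nonneg {p q : ℝ} (hpq : p.HolderConjugate q) (x v : E) : 0 ≤ bregman p x v := by
  have h := subgradient_of_mem_dualitySet hpq (dualityMap_mem hpq.lt x) v
  rw [bregman]
  linarith

lemma bregman_self (p : ℝ) (x : E) : bregman p x x = 0 := by simp [bregman]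

lemma bregman_three_point (p : ℝ) (x w v : E) :
    bregman p x v = bregman p x w + bregman p w v +
      (dualityMap p w - dualityMap p x) (v - w) := by
  simp only [bregman, map_sub, sub_apply]
  ring

lemma norm_sub_le_of_isConvexityConst {p Cp : ℝ} (hp : 1 < p) (hCp : IsConvexityConst E p Cp)
    (x v : E) : ‖x - v‖ ≤ (Cp / p) ^ (-1 / p) * bregman p x v ^ (1 / p) := by
  have hc : 0 < Cp / p := div_pos hCp.1 (by linarith)
  have hp0 : p ≠ 0 := by linarith
  have h1 := Real.rpow_le_rpow (by positivity) (hCp.2 x v) (z := 1 / p) (by positivity)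
  rw [Real.mul_rpow hc.le (by positivity), ← Real.rpow_mul (norm_nonneg _), mul_one_div_cancel hp0,
    Real.rpow_one] at h1
  calc ‖x - v‖ = (Cp / p) ^ (-1 / p) * ((Cp / p) ^ (1 / p) * ‖x - v‖) := by
        rw [← mul_assoc, ← Real.rpow_add hc]; ring_nf; simp
    _ ≤ _ := by gcongr

/-- The Bregman distance to `v` decreases along the segment towards `v`. -/
lemma bregman_le_of_mem_segment {p q : ℝ} (hpq : p.HolderConjugate q) {x v w : E}
    (hw : w ∈ segment ℝ x v) : bregman p w v ≤ bregman p x v := by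
  rw [segment_eq_image'] at hw
  obtain ⟨t, ⟨ht0, ht1⟩, rfl⟩ := hw
  rcases ht0.eq_or_lt with rfl | ht
  · simp
  set w := x + t • (v - x) with hw
  have h1 := bregman_three_point p x w v
  have h2 := bregman_nonneg hpq x w
  have h3 := bregman_nonneg hpq w x
  have h4 : 0 ≤ (dualityMap p w - dualityMap p x) (w - x) := by
    have := bregman_three_point p x w x
    rw [bregman_self, ← neg_sub w x, map_neg] at this
    linarith
  -- As `v - w` is a nonnegative multiple of `w - x`, monotonicity of the duality mapping (`h4`)
  -- gives the cross term its sign.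
  have h5 : v - w = ((1 - t) / t) • (w - x) := by
    rw [hw, add_sub_cancel_left, smul_smul, div_mul_cancel₀ _ ht.ne']
    module
  rw [h5, map_smul, smul_eq_mul] at h1
  have h6 : 0 ≤ (1 - t) / t * (dualityMap p w - dualityMap p x) (w - x) :=
    mul_nonneg (div_nonneg (by linarith) ht.le) h4
  linarith

/-! ### Smoothness: the duality mapping as a derivative. -/

/-- Homogeneity: normalise `x` and `k` and use the modulus at `τ = ‖k‖ / ‖x‖`. -/
lemma norm_add_norm_sub_le_of_smoothnessModulus {q C : ℝ}
    (hC : ∀ τ : ℝ, 0 < τ → smoothnessModulus E τ ≤ ((C * τ ^ q : ℝ) : EReal)) {x : E}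
    (hx : x ≠ 0) {k : E} (hk : k ≠ 0) :
    ‖x + k‖ + ‖x - k‖ - 2 * ‖x‖ ≤ 2 * C * ‖x‖ ^ (1 - q) * ‖k‖ ^ q := by
  have hx' : 0 < ‖x‖ := norm_pos_iff.2 hx
  have hk' : 0 < ‖k‖ := norm_pos_iff.2 hk
  have h := hC (‖k‖ / ‖x‖) (by positivity)
  simp only [smoothnessModulus, iSup_le_iff, EReal.coe_le_coe_iff] at h
  have h1 := h (‖x‖⁻¹ • x) (‖k‖⁻¹ • k)
    ⟨by rw [norm_smul, norm_inv, norm_norm, inv_mul_cancel₀ hx'.ne'],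
      by rw [norm_smul, norm_inv, norm_norm, inv_mul_cancel₀ hk'.ne']⟩
  have e : (‖k‖ / ‖x‖) • ‖k‖⁻¹ • k = ‖x‖⁻¹ • k := by
    rw [smul_smul]; congr 1; field_simp
  rw [e, ← smul_add, ← smul_sub, norm_smul, norm_smul, norm_inv, norm_norm,
    Real.div_rpow hk'.le hx'.le] at h1
  have h2 := mul_le_mul_of_nonneg_left h1 (by positivity : 0 ≤ 2 * ‖x‖)
  rw [Real.rpow_sub hx', Real.rpow_one]
  calc _ = 2 * ‖x‖ * (1 / 2 * (‖x‖⁻¹ * ‖x + k‖ + ‖x‖⁻¹ * ‖x - k‖ - 2)) := by field_simp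
    _ ≤ _ := h2
    _ = _ := by ring

/-- In a smooth space of power type the norm is Fréchet differentiable off the origin. -/
lemma hasFDerivAt_norm_of_isQSmooth {q : ℝ} (hq : 1 < q) (hE : IsQSmooth E q) {x : E}
    (hx : x ≠ 0) {g : StrongDual ℝ E} (hg : ‖g‖ = 1) (hgx : g x = ‖x‖) :
    HasFDerivAt (fun v : E => ‖v‖) g x := by
  obtain ⟨C, -, hC⟩ := hE
  have hle : ∀ v, g v ≤ ‖v‖ := fun v =>
    (le_abs_self _).trans ((g.le_opNorm v).trans_eq (by rw [hg, one_mul]))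
  rw [hasFDerivAt_iff_isLittleO_nhds_zero]
  refine IsBigO.trans_isLittleO (IsBigO.of_bound (2 * C * ‖x‖ ^ (1 - q))
    (Eventually.of_forall fun k => ?_)) (isLittleO_norm_rpow hq)
  rw [Real.norm_of_nonneg (Real.rpow_nonneg (norm_nonneg k) q)]
  rcases eq_or_ne k 0 with rfl | hk
  · simp [Real.zero_rpow (by linarith : q ≠ 0)]
  -- As `g (x - k) ≤ ‖x - k‖`, the nonnegative remainder at `k` is at most the symmetric second
  -- difference.
  · have h1 := norm_add_norm_sub_le_of_smoothnessModulus hC hx hk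
    have h2 := hle (x + k)
    have h3 := hle (x - k)
    rw [map_add] at h2
    rw [map_sub] at h3
    rw [Real.norm_of_nonneg (by linarith)]
    linarith

/-- In a smooth space of power type the duality mapping is the derivative of `‖·‖ ^ p / p`. -/
lemma hasFDerivAt_of_mem_dualitySet {p q : ℝ} (hp : 1 < p) (hq : 1 < q) (hE : IsQSmooth E q)
    {x : E} {f : StrongDual ℝ E} (hf : f ∈ dualitySet p x) :
    HasFDerivAt (fun v : E => 1 / p * ‖v‖ ^ p) f x := by
  rcases eq_or_ne x 0 with rfl | hx
  · have hf0 : f = 0 := by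
      rw [← norm_eq_zero, hf.2, norm_zero, Real.zero_rpow (sub_pos.2 hp).ne']
    rw [hasFDerivAt_iff_isLittleO_nhds_zero, hf0]
    simpa [Real.zero_rpow (by linarith : p ≠ 0)] using (isLittleO_norm_rpow hp).const_mul_left p⁻¹
  · have hn : 0 < ‖x‖ := norm_pos_iff.2 hx
    have hn' : 0 < ‖x‖ ^ (p - 1) := Real.rpow_pos_of_pos hn _
    have hg : HasFDerivAt (fun v : E => ‖v‖) ((‖x‖ ^ (p - 1))⁻¹ • f) x := by
      refine hasFDerivAt_norm_of_isQSmooth hq hE hx ?_ ?_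
      · rw [norm_smul, hf.2, norm_inv, Real.norm_of_nonneg hn'.le, inv_mul_cancel₀ hn'.ne']
      · rw [smul_apply, hf.1, hf.2, smul_eq_mul]
        field_simp
    have h := (hg.rpow_const (p := p) (Or.inl hn.ne')).const_mul (1 / p)
    have e : (1 / p) • (p * ‖x‖ ^ (p - 1)) • (‖x‖ ^ (p - 1))⁻¹ • f = f := by
      have hc : 1 / p * (p * ‖x‖ ^ (p - 1)) * (‖x‖ ^ (p - 1))⁻¹ = 1 := by field_simp
      rw [smul_smul, smul_smul, hc, one_smul]
    rwa [e] at h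

/-- Both functionals are derivatives of `‖·‖ ^ p / p` at `x`, so the choice in `dualityMap` is
immaterial. -/
lemma dualityMap_eq_of_mem {p q : ℝ} (hp : 1 < p) (hq : 1 < q) (hE : IsQSmooth E q)
    {x : E} {f : StrongDual ℝ E} (hf : f ∈ dualitySet p x) : dualityMap p x = f :=
  (hasFDerivAt_of_mem_dualitySet hp hq hE (dualityMap_mem hp x)).unique
    (hasFDerivAt_of_mem_dualitySet hp hq hE hf)

/-! ### Convexity: existence of minimisers. -/

/-- The functional `‖·‖ ^ p / p - f` is uniformly convex. -/
lemma norm_rpow_midpoint {p Cp : ℝ} (hCp : IsConvexityConst E p Cp) (f : StrongDual ℝ E)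
    (u v : E) :
    2 * (Cp / p * ‖(1 / 2 : ℝ) • (u - v)‖ ^ p) ≤ (1 / p * ‖u‖ ^ p - f u) +
      (1 / p * ‖v‖ ^ p - f v) - 2 * (1 / p * ‖midpoint ℝ u v‖ ^ p - f (midpoint ℝ u v)) := by
  set m := midpoint ℝ u v with hm
  have hm' : m = (1 / 2 : ℝ) • (u + v) := by rw [hm, midpoint_eq_smul_add]; simp
  -- The linear terms of the two Bregman distances from the midpoint cancel in the sum.
  have h1 := hCp.2 m u
  have h2 := hCp.2 m v
  have e1 : m - u = -((1 / 2 : ℝ) • (u - v)) := by rw [hm']; module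
  have e2 : m - v = (1 / 2 : ℝ) • (u - v) := by rw [hm']; module
  have e3 : f u + f v = 2 * f m := by rw [hm']; simp; ring
  have e4 : dualityMap p m u + dualityMap p m v = 2 * dualityMap p m m := by
    generalize dualityMap p m = g
    rw [hm']; simp; ring
  rw [e1, norm_neg] at h1
  rw [e2] at h2
  simp only [bregman, map_sub] at h1 h2
  linarith

/-- `‖·‖ ^ p / p - f` attains its minimum on nonempty closed convex sets. -/
lemma exists_minimizer [CompleteSpace E] {p q Cp : ℝ} (hpq : p.HolderConjugate q)
    (hCp : IsConvexityConst E p Cp) {Z : Set E} (hne : Z.Nonempty) (hcl : IsClosed Z)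
    (hcv : Convex ℝ Z) (f : StrongDual ℝ E) :
    ∃ u ∈ Z, ∀ v ∈ Z, 1 / p * ‖u‖ ^ p - f u ≤ 1 / p * ‖v‖ ^ p - f v := by
  have hp : 1 < p := hpq.lt
  have hp0 : 0 < p := hpq.pos
  have hc : 0 < Cp / p := div_pos hCp.1 hp0
  set φ : E → ℝ := fun v => 1 / p * ‖v‖ ^ p - f v with hφ
  have hφc : Continuous φ :=
    ((continuous_norm.rpow_const fun _ => Or.inr hp0.le).const_mul _).sub f.continuous
  have hbdd : BddBelow (φ '' Z) := by
    refine ⟨-(1 / q * ‖f‖ ^ q), ?_⟩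
    rintro _ ⟨v, -, rfl⟩
    have := apply_le_young hpq f v
    simp only [hφ]
    linarith
  set m := sInf (φ '' Z) with hm
  have hmle : ∀ v ∈ Z, m ≤ φ v := fun v hv => csInf_le hbdd ⟨v, hv, rfl⟩
  have hex : ∀ n : ℕ, ∃ v ∈ Z, φ v < m + 1 / ((n : ℝ) + 1) := fun n => by
    obtain ⟨_, ⟨v, hv, rfl⟩, h⟩ := exists_lt_of_csInf_lt (hne.image φ)
      (lt_add_of_pos_right m (by positivity : 0 < 1 / ((n : ℝ) + 1)))
    exact ⟨v, hv, h⟩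
  choose u huZ hu using hex
  have hlim : Tendsto (fun n : ℕ => 1 / ((n : ℝ) + 1)) atTop (𝓝 0) :=
    tendsto_one_div_add_atTop_nhds_zero_nat
  -- Midpoints stay in `Z`, where `φ ≥ m`, so uniform convexity bounds the mutual distances of
  -- near-minimisers.
  have hcauchy : CauchySeq u := by
    refine cauchySeq_of_le_tendsto_0
      (fun n => 2 * ((Cp / p)⁻¹ * (1 / ((n : ℝ) + 1))) ^ (1 / p)) (fun n k M hn hk => ?_) ?_
    · have h1 := norm_rpow_midpoint hCp f (u n) (u k)
      have h2 := hmle _ (hcv.midpoint_mem (huZ n) (huZ k))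
      have hn' : 1 / ((n : ℝ) + 1) ≤ 1 / ((M : ℝ) + 1) := by gcongr
      have hk' : 1 / ((k : ℝ) + 1) ≤ 1 / ((M : ℝ) + 1) := by gcongr
      have h3 := hu n
      have h4 := hu k
      simp only [hφ] at h2 h3 h4
      have h5 : Cp / p * ‖(1 / 2 : ℝ) • (u n - u k)‖ ^ p ≤ 1 / ((M : ℝ) + 1) := by linarith
      have h6 : ‖(1 / 2 : ℝ) • (u n - u k)‖ ≤ ((Cp / p)⁻¹ * (1 / ((M : ℝ) + 1))) ^ (1 / p) := by
        rw [one_div p, Real.le_rpow_inv_iff_of_pos (norm_nonneg _) (by positivity) hp0,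
          le_inv_mul_iff₀ hc]
        exact h5
      rw [norm_smul] at h6
      norm_num at h6
      rw [dist_eq_norm]
      norm_num
      linarith
    · have h1 : Tendsto (fun n : ℕ => (Cp / p)⁻¹ * (1 / ((n : ℝ) + 1))) atTop (𝓝 0) := by
        simpa using hlim.const_mul (Cp / p)⁻¹
      have h2 := (h1.rpow_const (p := 1 / p) (Or.inr (by positivity))).const_mul 2
      rwa [Real.zero_rpow (by positivity), mul_zero] at h2
  obtain ⟨w, hw⟩ := cauchySeq_tendsto_of_complete hcauchy
  refine ⟨w, hcl.mem_of_tendsto hw (Eventually.of_forall huZ), fun v hv => ?_⟩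
  have h1 : Tendsto (fun n => φ (u n)) atTop (𝓝 (φ w)) := (hφc.tendsto w).comp hw
  have h2 : Tendsto (fun n : ℕ => m + 1 / ((n : ℝ) + 1)) atTop (𝓝 m) := by
    simpa using hlim.const_add m
  exact (le_of_tendsto_of_tendsto' h1 h2 fun n => (hu n).le).trans (hmle v hv)

/-! ### Inverse duality mappings, dual steps and Bregman projections. -/

/-- The gauges `t ^ (p - 1)` and `t ^ (q - 1)` are mutually inverse because `(p - 1) * (q - 1) = 1`.
-/
lemma inclusionInDoubleDual_mem_dualitySet_iff {p q : ℝ} (hpq : p.HolderConjugate q) {x : E}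
    {f : StrongDual ℝ E} :
    NormedSpace.inclusionInDoubleDual ℝ E x ∈ dualitySet q f ↔ f ∈ dualitySet p x := by
  have hn : ‖NormedSpace.inclusionInDoubleDual ℝ E x‖ = ‖x‖ :=
    (NormedSpace.inclusionInDoubleDualLi ℝ (E := E)).norm_map x
  have hmul : (p - 1) * (q - 1) = 1 := by linarith [hpq.mul_eq_add]
  simp only [dualitySet, Set.mem_ofPred_eq, hn, NormedSpace.dual_def]
  refine and_congr (by rw [mul_comm]) ⟨fun h => ?_, fun h => ?_⟩
  · rw [h, ← Real.rpow_mul (norm_nonneg f), mul_comm, hmul, Real.rpow_one]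
  · rw [h, ← Real.rpow_mul (norm_nonneg x), hmul, Real.rpow_one]

/-- The duality mapping is onto, with right inverse the duality mapping of the dual space. -/
lemma dualityMap_dualityMapStar [CompleteSpace E] {p q Cp : ℝ} (hpq : p.HolderConjugate q)
    (hCp : IsConvexityConst E p Cp) (hE : IsQSmooth E q) (f : StrongDual ℝ E) :
    dualityMap p (dualityMapStar q f) = f := by
  -- At a global minimiser of `‖·‖ ^ p / p - f` the derivative vanishes, which says that `f` is in
  -- the duality set of `u`.
  obtain ⟨u, -, hu⟩ := exists_minimizer hpq hCp Set.univ_nonempty isClosed_univ convex_univ f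
  have hmem := dualityMap_mem hpq.lt u
  have hd := (hasFDerivAt_of_mem_dualitySet hpq.lt hpq.symm.lt hE hmem).sub f.hasFDerivAt
  have hmin : IsLocalMin ((fun v : E => 1 / p * ‖v‖ ^ p) - fun v => f v) u :=
    Eventually.of_forall fun v => hu v (Set.mem_univ v)
  have h0 := hmin.hasFDerivAt_eq_zero hd
  rw [sub_eq_zero.1 h0] at hmem
  have hex : ∃ x, NormedSpace.inclusionInDoubleDual ℝ E x ∈ dualitySet q f :=
    ⟨u, (inclusionInDoubleDual_mem_dualitySet_iff hpq).2 hmem⟩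
  exact dualityMap_eq_of_mem hpq.lt hpq.symm.lt hE
    ((inclusionInDoubleDual_mem_dualitySet_iff hpq).1 (Classical.epsilon_spec hex))

/-- The duality mapping of the dual space inverts `dualityMap`. -/
lemma dualityMap_dual_dualityMap {p q Gq : ℝ} (hpq : p.HolderConjugate q)
    (hGq : IsDualSmoothnessConst E q Gq) (x : E) :
    dualityMap q (dualityMap p x) = NormedSpace.inclusionInDoubleDual ℝ E x := by
  set f := dualityMap p x
  have hmem := (inclusionInDoubleDual_mem_dualitySet_iff hpq).2 (dualityMap_mem hpq.lt x)
  -- The inclusion of `x` is a subgradient at `f`, while `Gq` bounds the first-order remainder for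
  -- `dualityMap q f` from above; their difference is therefore superlinearly small.
  refine (sub_eq_zero.1 (eq_zero_of_le_rpow (c := Gq / q) hpq.symm.lt fun h => ?_)).symm
  have h1 := hGq.2 f (f + h)
  have h2 := subgradient_of_mem_dualitySet hpq.symm hmem (f + h)
  have e : f - (f + h) = -h := by abel
  rw [e, norm_neg] at h1
  rw [bregman] at h1
  rw [add_sub_cancel_left] at h1 h2
  rw [sub_apply]
  linarith

/-- The Bregman distance after a step in the dual space. -/
lemma bregman_dual_step_le [CompleteSpace E] {p q Cp Gq : ℝ} (hpq : p.HolderConjugate q)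
    (hCp : IsConvexityConst E p Cp) (hE : IsQSmooth E q) (hGq : IsDualSmoothnessConst E q Gq)
    (x v : E) (T : StrongDual ℝ E) :
    bregman p (dualityMapStar q (dualityMap p x - T)) v ≤
      bregman p x v + Gq / q * ‖T‖ ^ q + T (v - x) := by
  rw [bregman_eq_conj hpq, bregman_eq_conj hpq, dualityMap_dualityMapStar hpq hCp hE]
  have h := hGq.2 (dualityMap p x) (dualityMap p x - T)
  rw [sub_sub_cancel, bregman, dualityMap_dual_dualityMap hpq hGq, NormedSpace.dual_def] at h
  simp only [sub_apply, map_sub] at h ⊢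
  linarith

lemma bregmanProj_spec [CompleteSpace E] {p q Cp : ℝ} (hpq : p.HolderConjugate q)
    (hCp : IsConvexityConst E p Cp) {Z : Set E} (hne : Z.Nonempty) (hcl : IsClosed Z)
    (hcv : Convex ℝ Z) (x : E) :
    bregmanProj p Z x ∈ Z ∧ ∀ w ∈ Z, bregman p x (bregmanProj p Z x) ≤ bregman p x w := by
  obtain ⟨u, huZ, hu⟩ := exists_minimizer hpq hCp hne hcl hcv (dualityMap p x)
  have hex : ∃ z, z ∈ Z ∧ ∀ w ∈ Z, bregman p x z ≤ bregman p x w := by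
    refine ⟨u, huZ, fun w hw => ?_⟩
    have := hu w hw
    simp only [bregman, map_sub]
    linarith
  exact Classical.epsilon_spec hex

/-- The Bregman projection onto a convex set does not increase the distance to its points. -/
lemma bregman_bregmanProj_le [CompleteSpace E] {p q Cp : ℝ} (hpq : p.HolderConjugate q)
    (hCp : IsConvexityConst E p Cp) (hE : IsQSmooth E q) {Z : Set E} (hcl : IsClosed Z)
    (hcv : Convex ℝ Z) (x : E) {v : E} (hv : v ∈ Z) :
    bregman p (bregmanProj p Z x) v ≤ bregman p x v := by
  obtain ⟨hP, hmin⟩ := bregmanProj_spec hpq hCp ⟨v, hv⟩ hcl hcv x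
  set P := bregmanProj p Z x
  have hd := (hasFDerivAt_of_mem_dualitySet hpq.lt hpq.symm.lt hE
    (dualityMap_mem hpq.lt P)).sub (dualityMap p x).hasFDerivAt
  have hlm : IsLocalMinOn ((fun v : E => 1 / p * ‖v‖ ^ p) - fun v => dualityMap p x v) Z P := by
    refine IsMinOn.localize fun w hw => ?_
    have := hmin w hw
    simp only [bregman, map_sub] at this
    simp only [Set.mem_ofPred_eq, Pi.sub_apply]
    linarith
  -- This variational inequality is the sign of the cross term in the three-point identity.
  have h1 := hlm.hasFDerivWithinAt_nonneg hd.hasFDerivWithinAt (y := v - P)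
    (mem_posTangentConeAt_of_segment_subset (by
      rw [add_sub_cancel]; exact hcv.segment_subset hP hv))
  have h2 := bregman_three_point p x P v
  have h3 := bregman_nonneg hpq x P
  linarith

end Geometry

/-! ### Taylor remainder and scalar estimates for the step size. -/

lemma norm_taylor_le {X Y : Type*} [NormedAddCommGroup X] [NormedSpace ℝ X]
    [NormedAddCommGroup Y] [NormedSpace ℝ Y] {F : X → Y} {DF : X → X →L[ℝ] Y} {x v : X} {L : ℝ}
    (hF : ∀ w ∈ segment ℝ x v, HasFDerivWithinAt F (DF w) (segment ℝ x v) w)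
    (hL : ∀ w ∈ segment ℝ x v, ‖DF w - DF x‖ ≤ L * ‖w - x‖) :
    ‖F v - F x - DF x (v - x)‖ ≤ L / 2 * ‖v - x‖ ^ 2 := by
  set d := v - x with hd
  have hseg : ∀ t ∈ Set.Icc (0 : ℝ) 1, x + t • d ∈ segment ℝ x v := fun t ht => by
    rw [segment_eq_image']; exact ⟨t, ht, rfl⟩
  have hder : ∀ t ∈ Set.Icc (0 : ℝ) 1, HasDerivWithinAt
      (fun s : ℝ => F (x + s • d) - F x - s • DF x d) (DF (x + t • d) d - DF x d)
      (Set.Icc 0 1) t := fun t ht => by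
    have h1 : HasDerivAt (fun s : ℝ => x + s • d) d t := by
      simpa using ((hasDerivAt_id t).smul_const d).const_add x
    have h2 : HasDerivAt (fun s : ℝ => s • DF x d) (DF x d) t := by
      simpa using (hasDerivAt_id t).smul_const (DF x d)
    exact (((hF _ (hseg t ht)).comp_hasDerivWithinAt t h1.hasDerivWithinAt hseg).sub_const
      (F x)).sub h2.hasDerivWithinAt
  have hB : ∀ t : ℝ, HasDerivAt (fun s : ℝ => L / 2 * ‖d‖ ^ 2 * s ^ 2) (L * ‖d‖ ^ 2 * t) t :=
    fun t => by
      have e : L / 2 * ‖d‖ ^ 2 * (((2 : ℕ) : ℝ) * t ^ (2 - 1)) = L * ‖d‖ ^ 2 * t := by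
        push_cast
        ring
      exact e ▸ (hasDerivAt_pow 2 t).const_mul (L / 2 * ‖d‖ ^ 2)
  have h := image_norm_le_of_norm_deriv_right_le_deriv_boundary
    (f := fun s : ℝ => F (x + s • d) - F x - s • DF x d) (a := 0) (b := 1)
    (f' := fun t => DF (x + t • d) d - DF x d)
    (fun t ht => (hder t ht).continuousWithinAt)
    (fun t ht => (hder t ⟨ht.1, ht.2.le⟩).mono_of_mem_nhdsWithin
      (mem_of_superset (Icc_mem_nhdsGE ht.2) (Set.Icc_subset_Icc_left ht.1)))
    (B := fun s : ℝ => L / 2 * ‖d‖ ^ 2 * s ^ 2) (B' := fun t => L * ‖d‖ ^ 2 * t)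
    (by simp) hB
    (fun t ht => by
      have h1 := hL _ (hseg t ⟨ht.1, ht.2.le⟩)
      rw [add_sub_cancel_left, norm_smul, Real.norm_of_nonneg ht.1] at h1
      calc ‖DF (x + t • d) d - DF x d‖ ≤ ‖DF (x + t • d) - DF x‖ * ‖d‖ :=
            (DF (x + t • d) - DF x).le_opNorm d
        _ ≤ L * (t * ‖d‖) * ‖d‖ := by gcongr
        _ = L * ‖d‖ ^ 2 * t := by ring)
    (Set.right_mem_Icc.2 zero_le_one)
  simpa [hd] using h

/-- A lower bound, between the roots, for the quadratic in the step size. -/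
lemma quadratic_lower_bound {c η ε r s : ℝ} (hc : 0 < c) (hη : 0 ≤ η) (hε : 0 ≤ ε)
    (hsmall : 8 * c * η ≤ 1) (hr : (3 + ε) * η ≤ r)
    (hrs : r + η ≤ s) (hs : s ≤ (1 + √(1 - 8 * c * η)) / (2 * c)) :
    c * (ε * η) * ((1 + √(1 - 8 * c * η)) / (2 * c) - s) ≤
      -c * r ^ 2 + (1 - 2 * c * η) * r - η - c * η ^ 2 := by
  set D := √(1 - 8 * c * η)
  have hD0 : 0 ≤ D := Real.sqrt_nonneg _
  have hD : D ^ 2 = 1 - 8 * c * η := Real.sq_sqrt (by linarith)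
  have hD1 : D ≤ 1 := by nlinarith [mul_nonneg hc.le hη]
  -- In terms of `r + η` the quadratic is `-c (r + η) ^ 2 + (r + η) - 2 η`, with roots `(1 ± D) / (2
  -- c)`.
  have e : -c * r ^ 2 + (1 - 2 * c * η) * r - η - c * η ^ 2 =
      c * (r + η - (1 - D) / (2 * c)) * ((1 + D) / (2 * c) - (r + η)) := by
    have h1 : (1 + D) / (2 * c) * (c * ((1 - D) / (2 * c))) = 2 * η := by
      field_simp
      nlinarith
    have h2 : c * ((1 + D) / (2 * c)) + c * ((1 - D) / (2 * c)) = 1 := by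
      field_simp
      ring
    linear_combination (-(r + η)) * h2 + h1
  -- Equivalent to `D ^ 2 ≤ D`. This is the origin of the `3` in the threshold: `r + η ≥ (4 + ε) η`
  -- clears the lower root by `ε η`.
  have h3 : (1 - D) / (2 * c) ≤ 4 * η := by
    rw [div_le_iff₀ (by positivity)]
    nlinarith
  rw [e]
  have h4 : 0 ≤ (1 + D) / (2 * c) - s := by linarith
  have h5 : 0 ≤ ε * η := mul_nonneg hε hη
  have h6 : ε * η ≤ r + η - (1 - D) / (2 * c) := by linarith
  have h7 : 0 ≤ c * (r + η - (1 - D) / (2 * c)) := mul_nonneg hc.le (h5.trans h6)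
  gcongr

/-- The decrease achieved by the step size `μ = t ^ (-1 / (q - 1)) * ...`. -/
lemma stepSize_decrease {p q t u r : ℝ} (hpq : p.HolderConjugate q) (ht : 0 < t) (hu : 0 ≤ u)
    (hr : 0 ≤ r) :
    1 / q * t * (t ^ (-1 / (q - 1)) * u ^ (1 / (q - 1)) * r ^ ((p - 1) / (q - 1))) ^ q -
        (t ^ (-1 / (q - 1)) * u ^ (1 / (q - 1)) * r ^ ((p - 1) / (q - 1))) * (u * r ^ (p - 1)) =
      -(1 / p * ((u * r ^ (p - 1) / t) ^ (p - 1) * (u * r ^ (p - 1)))) := by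
  have hq1 : 0 < q - 1 := hpq.symm.sub_one_pos
  have hmul : (p - 1) * (q - 1) = 1 := by linarith [hpq.mul_eq_add]
  have e1 : 1 / (q - 1) = p - 1 := by rw [div_eq_iff hq1.ne', hmul]
  have ha : 0 ≤ r ^ (p - 1) := Real.rpow_nonneg hr _
  -- With `a = u * r ^ (p - 1)`, the step size is `(a / t) ^ (p - 1)`, the minimiser of `μ ↦ t * μ ^
  -- q / q - μ * a`.
  have e : t ^ (-1 / (q - 1)) * u ^ (1 / (q - 1)) * r ^ ((p - 1) / (q - 1)) =
      (u * r ^ (p - 1) / t) ^ (p - 1) := by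
    rw [neg_div, div_eq_mul_one_div (p - 1) (q - 1), e1, Real.div_rpow (mul_nonneg hu ha) ht.le,
      Real.mul_rpow hu ha, ← Real.rpow_mul hr, Real.rpow_neg ht.le]
    ring
  rw [e]
  set a := u * r ^ (p - 1) with ha'
  have ha0 : 0 ≤ a / t := div_nonneg (mul_nonneg hu ha) ht.le
  have e2 : ((a / t) ^ (p - 1)) ^ q = (a / t) ^ (p - 1) * (a / t) := by
    rw [← Real.rpow_mul ha0, hpq.sub_one_mul_conj]
    conv_rhs => rw [← Real.rpow_add_one' ha0 (by linarith [hpq.pos])]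
    ring_nf
  have e3 : 1 / q = 1 - 1 / p := by
    have := hpq.one_div_add_one_div
    rw [div_one] at this
    linarith
  rw [e2, e3]
  field_simp
  ring

/-- The powers of `r` cancel since `(p - 1) * q = p`, leaving a decrease uniform in the iterate. -/
lemma decrease_lower_bound {p q G M t u r δ : ℝ} (hpq : p.HolderConjugate q) (hG : 0 < G)
    (hM : 0 < M) (ht : 0 < t) (hr : 0 < r) (htle : t ≤ G * (r ^ (p - 1) * M) ^ q) (hδ : 0 ≤ δ)
    (hδu : δ ≤ u) :
    (δ / (G * M ^ q)) ^ (p - 1) * δ ≤ (u * r ^ (p - 1) / t) ^ (p - 1) * (u * r ^ (p - 1)) := by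
  have hp1 : 0 ≤ p - 1 := hpq.sub_one_pos.le
  have e : (r ^ (p - 1) * M) ^ q = r ^ (p - 1) * r * M ^ q := by
    rw [Real.mul_rpow (by positivity) hM.le, ← Real.rpow_mul hr.le, hpq.sub_one_mul_conj,
      Real.rpow_sub_one hr.ne']
    field_simp
  have h1 : δ / (G * M ^ q) / r ≤ u * r ^ (p - 1) / t := by
    rw [div_div, div_le_div_iff₀ (by positivity) ht]
    calc δ * t ≤ u * (G * (r ^ (p - 1) * M) ^ q) := by gcongr; linarith
      _ = _ := by rw [e]; ring
  calc (δ / (G * M ^ q)) ^ (p - 1) * δ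
      = (δ / (G * M ^ q) / r) ^ (p - 1) * (δ * r ^ (p - 1)) := by
        rw [Real.div_rpow (by positivity) hr.le]
        field_simp
    _ ≤ _ := by
      have h2 : 0 ≤ u * r ^ (p - 1) / t := le_trans (by positivity) h1
      gcongr

/-! ### The descent iteration on one level. -/

namespace Level

variable {X Y : Type*} [NormedAddCommGroup X] [NormedSpace ℝ X]
  [NormedAddCommGroup Y] [NormedSpace ℝ Y] {l : Level X Y} {p q Cp Gq : ℝ} {y : Y} {z : X}
  {B : Set X}

lemma eta_nonneg (l : Level X Y) (y : Y) : 0 ≤ l.eta y := Metric.infDist_nonneg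

lemma Regular.Ctilde_pos (h : l.Regular p B) (hp : 0 < p) (hCp : 0 < Cp) :
    0 < l.Ctilde p Cp := by
  have := h.L_pos
  have := h.C_pos
  unfold Ctilde
  positivity

lemma radiusBase_pos (hc : 0 < l.Ctilde p Cp) (hsmall : 8 * l.Ctilde p Cp * l.eta y ≤ 1) :
    0 < l.radiusBase p Cp y := by
  have h1 : 4 * l.eta y ≤ 1 / (2 * l.Ctilde p Cp) := by
    rw [le_div_iff₀ (by positivity)]
    linarith
  have h2 : 1 / (2 * l.Ctilde p Cp) ≤
      (1 + √(1 - 8 * l.Ctilde p Cp * l.eta y)) / (2 * l.Ctilde p Cp) := by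
    gcongr
    linarith [Real.sqrt_nonneg (1 - 8 * l.Ctilde p Cp * l.eta y)]
  have h3 : 0 < 1 / (2 * l.Ctilde p Cp) := by positivity
  have h4 := l.eta_nonneg y
  unfold radiusBase
  linarith

lemma radius_pos (hL : 0 < l.Lhat) (hp : 0 < p) (hCp : 0 < Cp)
    (hb : 0 < l.radiusBase p Cp y) : 0 < l.radius p Cp y := by
  unfold radius
  positivity

lemma lt_radiusBase_of_lt_radius (hL : 0 < l.Lhat) (hp : 0 < p) (hCp : 0 < Cp)
    (hb : 0 < l.radiusBase p Cp y) {d : ℝ} (hd0 : 0 ≤ d) (hd : d < l.radius p Cp y) :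
    l.Lhat * ((Cp / p) ^ (-1 / p) * d ^ (1 / p)) < l.radiusBase p Cp y := by
  have hc : 0 < Cp / p := by positivity
  have h1 : d ^ (1 / p) < l.radius p Cp y ^ (1 / p) := Real.rpow_lt_rpow hd0 hd (by positivity)
  have e : l.radius p Cp y ^ (1 / p) =
      (Cp / p) ^ (1 / p) * l.Lhat⁻¹ * l.radiusBase p Cp y := by
    rw [radius, Real.mul_rpow (by positivity) (by positivity),
      Real.mul_rpow (by positivity) (by positivity), ← Real.rpow_mul hL.le, ← Real.rpow_mul hb.le,
      mul_one_div_cancel hp.ne', Real.rpow_one, neg_mul, mul_one_div_cancel hp.ne',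
      Real.rpow_neg_one]
  rw [e] at h1
  calc l.Lhat * ((Cp / p) ^ (-1 / p) * d ^ (1 / p))
      < l.Lhat * ((Cp / p) ^ (-1 / p) *
          ((Cp / p) ^ (1 / p) * l.Lhat⁻¹ * l.radiusBase p Cp y)) := by gcongr
    _ = l.radiusBase p Cp y := by
      rw [neg_div, Real.rpow_neg hc.le]
      field_simp

/-- The standing assumptions under which the descent iteration on one level is analysed. -/
structure Admissible (l : Level X Y) (p q Cp Gq : ℝ) (y : Y) (z : X) (B : Set X) : Prop where
  holder : p.HolderConjugate q
  smooth : IsQSmooth X q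
  convexityConst : IsConvexityConst X p Cp
  smoothnessConst : IsDualSmoothnessConst X q Gq
  regular : l.Regular p B
  best : l.IsBestApprox y z
  ball_subset : {x | bregman p x z ≤ l.radius p Cp y} ∩ l.Z ⊆ B
  small : 8 * l.Ctilde p Cp * l.eta y ≤ 1

namespace Admissible

lemma Ctilde_pos (h : l.Admissible p q Cp Gq y z B) :
    0 < l.Ctilde p Cp := h.regular.Ctilde_pos h.holder.pos h.convexityConst.1

lemma radiusBase_pos (h : l.Admissible p q Cp Gq y z B) :
    0 < l.radiusBase p Cp y := Level.radiusBase_pos h.Ctilde_pos h.small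

lemma radius_pos (h : l.Admissible p q Cp Gq y z B) : 0 < l.radius p Cp y :=
  Level.radius_pos h.regular.Lhat_pos h.holder.pos h.convexityConst.1 h.radiusBase_pos

lemma mem_of_bregman_le (h : l.Admissible p q Cp Gq y z B)
    {x : X} (hx : x ∈ l.Z) (hd : bregman p x z ≤ l.radius p Cp y) :
    x ∈ B ∩ l.Z :=
  ⟨h.ball_subset ⟨hd, hx⟩, hx⟩

lemma best_mem (h : l.Admissible p q Cp Gq y z B) : z ∈ B ∩ l.Z :=
  h.mem_of_bregman_le h.best.1 (by rw [bregman_self]; exact h.radius_pos.le)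

/-- `B` need not be convex, but Bregman balls `{x | bregman p x z ≤ ρ}` are star-shaped about `z`;
this suffices for the mean value and Taylor estimates. -/
lemma segment_subset (h : l.Admissible p q Cp Gq y z B)
    {x : X} (hx : x ∈ l.Z) (hd : bregman p x z ≤ l.radius p Cp y) :
    segment ℝ x z ⊆ B ∩ l.Z := fun _ hw =>
  h.mem_of_bregman_le (h.regular.convex.segment_subset hx h.best.1 hw)
    ((bregman_le_of_mem_segment h.holder hw).trans hd)

lemma hasFDerivWithinAt_segment (h : l.Admissible p q Cp Gq y z B) {x : X} (hx : x ∈ l.Z)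
    (hd : bregman p x z ≤ l.radius p Cp y) :
    ∀ w ∈ segment ℝ x z, HasFDerivWithinAt l.F (l.DF w) (segment ℝ x z) w := fun w hw =>
  (h.regular.hasDeriv w (h.segment_subset hx hd hw)).mono
    (h.regular.convex.segment_subset hx h.best.1)

lemma norm_image_sub_le (h : l.Admissible p q Cp Gq y z B)
    {x : X} (hx : x ∈ l.Z) (hd : bregman p x z ≤ l.radius p Cp y) :
    ‖l.F x - l.F z‖ ≤ l.Lhat * ((Cp / p) ^ (-1 / p) * bregman p x z ^ (1 / p)) := by
  refine (Convex.norm_image_sub_le_of_norm_hasFDerivWithin_le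
    (h.hasFDerivWithinAt_segment hx hd)
    (fun w hw => h.regular.deriv_bound w (h.segment_subset hx hd hw))
    (convex_segment x z) (right_mem_segment ℝ x z) (left_mem_segment ℝ x z)).trans ?_
  exact mul_le_mul_of_nonneg_left
    (norm_sub_le_of_isConvexityConst h.holder.lt h.convexityConst x z) h.regular.Lhat_pos.le

lemma norm_image_sub_best_le (h : l.Admissible p q Cp Gq y z B)
    (x : X) : ‖l.F x - l.F z‖ ≤ ‖l.F x - y‖ + l.eta y := by
  rw [← h.best.2, norm_sub_rev (l.F z)]
  exact norm_sub_le_norm_sub_add_norm_sub _ _ _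

/-- The Taylor remainder is quadratic in `‖z - x‖`, which convexity and stability bound by the
residuals; `Ctilde` collects the constants. -/
lemma norm_linearization_le (h : l.Admissible p q Cp Gq y z B)
    {x : X} (hx : x ∈ l.Z) (hd : bregman p x z ≤ l.radius p Cp y) :
    ‖l.F z - l.F x - l.DF x (z - x)‖ ≤ l.Ctilde p Cp * (‖l.F x - y‖ + l.eta y) ^ 2 := by
  have hp := h.holder.pos
  have hc : 0 < Cp / p := div_pos h.convexityConst.1 hp
  have hL := h.regular.L_pos
  have hC := h.regular.C_pos
  have h1 := norm_taylor_le (h.hasFDerivWithinAt_segment hx hd) fun w hw =>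
    h.regular.deriv_lipschitz w (h.segment_subset hx hd hw) x (h.mem_of_bregman_le hx hd)
  have h2 := norm_sub_le_of_isConvexityConst h.holder.lt h.convexityConst x z
  have h3 : bregman p x z ^ (1 / p) ≤ l.C * ‖l.F x - l.F z‖ := by
    rw [one_div, Real.rpow_inv_le_iff_of_pos (bregman_nonneg h.holder x z) (by positivity) hp,
      Real.mul_rpow hC.le (norm_nonneg _)]
    exact h.regular.stability x (h.mem_of_bregman_le hx hd) z h.best_mem
  have h4 : ‖l.F x - l.F z‖ ≤ ‖l.F x - y‖ + l.eta y := h.norm_image_sub_best_le x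
  rw [norm_sub_rev] at h2
  calc _ ≤ l.L / 2 * ‖z - x‖ ^ 2 := h1
    _ ≤ l.L / 2 * ((Cp / p) ^ (-1 / p) * (l.C * (‖l.F x - y‖ + l.eta y))) ^ 2 := by
      have : ‖z - x‖ ≤ (Cp / p) ^ (-1 / p) * (l.C * (‖l.F x - y‖ + l.eta y)) :=
        h2.trans (by gcongr; exact h3.trans (by gcongr))
      gcongr
    _ = _ := by
      have e : (Cp / p) ^ (-2 / p) = ((Cp / p) ^ (-1 / p)) ^ 2 := by
        rw [← Real.rpow_mul_natCast hc.le]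
        congr 1
        push_cast
        ring
      rw [Ctilde, e]
      ring

/-- Write `DF x (z - x)` as `(F z - y) - remainder - (F x - y)`: the last term yields the descent,
the other two are errors of size `η` and `Ctilde * (r + η) ^ 2`. -/
lemma descentDir_apply_le (h : l.Admissible p q Cp Gq y z B)
    {j : Y → StrongDual ℝ Y} (hj : ∀ w, j w ∈ dualitySet p w) {x : X}
    (hx : x ∈ l.Z) (hd : bregman p x z ≤ l.radius p Cp y) :
    l.descentDir j y x (z - x) ≤
      -((-l.Ctilde p Cp * ‖l.F x - y‖ ^ 2 + (1 - 2 * l.Ctilde p Cp * l.eta y) * ‖l.F x - y‖ -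
        l.eta y - l.Ctilde p Cp * l.eta y ^ 2) * ‖l.F x - y‖ ^ (p - 1)) := by
  set r := ‖l.F x - y‖ with hr
  have hjx := hj (l.F x - y)
  have e : l.descentDir j y x (z - x) = j (l.F x - y) (l.F z - y)
      - j (l.F x - y) (l.F z - l.F x - l.DF x (z - x)) - j (l.F x - y) (l.F x - y) := by
    simp only [descentDir, ContinuousLinearMap.comp_apply, map_sub]
    ring
  have h1 : j (l.F x - y) (l.F z - y) ≤ r ^ (p - 1) * l.eta y := by
    rw [hr, ← hjx.2, ← h.best.2]
    exact (le_abs_self _).trans ((j (l.F x - y)).le_opNorm _)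
  have h2 : -j (l.F x - y) (l.F z - l.F x - l.DF x (z - x)) ≤
      r ^ (p - 1) * (l.Ctilde p Cp * (r + l.eta y) ^ 2) := by
    refine (neg_le_abs _).trans (((j (l.F x - y)).le_opNorm _).trans ?_)
    rw [hjx.2]
    gcongr
    exact h.norm_linearization_le hx hd
  have h3 : j (l.F x - y) (l.F x - y) = r * r ^ (p - 1) := by rw [hjx.1, hjx.2]
  rw [e, h3]
  linarith

/-- One step keeps the iterate in `Z` and decreases the Bregman distance to the best approximation
by a fixed amount. -/
lemma exists_step_decrease (h : l.Admissible p q Cp Gq y z B)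
    [CompleteSpace X] {j : Y → StrongDual ℝ Y}
    (hj : ∀ w, j w ∈ dualitySet p w) (hη : 0 < l.eta y) {ε d : ℝ} (hε : 0 < ε) (hd0 : 0 ≤ d)
    (hd : d < l.radius p Cp y) :
    ∃ κ > 0, ∀ x ∈ l.Z, bregman p x z ≤ d → (3 + ε) * l.eta y < ‖l.F x - y‖ →
      l.step p q Cp Gq j y x ∈ l.Z ∧
        bregman p (l.step p q Cp Gq j y x) z ≤ bregman p x z - κ := by
  have hpq := h.holder
  have hp := hpq.pos
  have hq := hpq.symm.pos
  have hL := h.regular.Lhat_pos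
  have hG := h.smoothnessConst.1
  have hct := h.Ctilde_pos
  have hcp : 0 < Cp / p := div_pos h.convexityConst.1 hp
  -- `M` bounds `‖F x - F z‖` on the part of `Z` at Bregman distance at most `d`; the gap between
  -- `M` and `radiusBase` makes `δ` a uniform lower bound for `u`.
  set M := l.Lhat * ((Cp / p) ^ (-1 / p) * d ^ (1 / p)) with hM
  have hMlt : M < l.radiusBase p Cp y :=
    lt_radiusBase_of_lt_radius hL hp h.convexityConst.1 h.radiusBase_pos hd0 hd
  set δ := l.Ctilde p Cp * (ε * l.eta y) * (l.radiusBase p Cp y - M) with hδ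
  have hδ0 : 0 < δ := by
    have : 0 < l.radiusBase p Cp y - M := sub_pos.2 hMlt
    positivity
  refine ⟨1 / p * ((δ / (Gq * l.Lhat ^ q)) ^ (p - 1) * δ), by positivity, fun x hx hxd hxr => ?_⟩
  have hxd' : bregman p x z ≤ l.radius p Cp y := hxd.trans hd.le
  refine ⟨(bregmanProj_spec hpq h.convexityConst ⟨z, h.best.1⟩ h.regular.isClosed
    h.regular.convex _).1, (bregman_bregmanProj_le hpq h.convexityConst h.smooth
    h.regular.isClosed h.regular.convex _ h.best.1).trans ?_⟩
  refine (bregman_dual_step_le hpq h.convexityConst h.smooth h.smoothnessConst x z _).trans ?_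
  have hT := h.descentDir_apply_le hj hx hxd'
  set T := l.descentDir j y x with hTdef
  have hrM : ‖l.F x - y‖ ≤ M + l.eta y := by
    have h1 := h.norm_image_sub_le hx hxd'
    have h2 : l.Lhat * ((Cp / p) ^ (-1 / p) * bregman p x z ^ (1 / p)) ≤ M := by
      have := bregman_nonneg hpq x z
      rw [hM]
      gcongr
    have h3 : ‖l.F x - y‖ ≤ ‖l.F x - l.F z‖ + ‖l.F z - y‖ :=
      norm_sub_le_norm_sub_add_norm_sub _ _ _
    rw [h.best.2] at h3
    linarith
  have hu := quadratic_lower_bound hct hη.le hε.le h.small hxr.le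
    (s := M + 2 * l.eta y) (by linarith) (by unfold radiusBase at hMlt; linarith)
  have hμ : l.stepSize p q Cp Gq j y x = (Gq * ‖T‖ ^ q) ^ (-1 / (q - 1)) *
    (-l.Ctilde p Cp * ‖l.F x - y‖ ^ 2 + (1 - 2 * l.Ctilde p Cp * l.eta y) * ‖l.F x - y‖ -
        l.eta y - l.Ctilde p Cp * l.eta y ^ 2) ^ (1 / (q - 1)) *
      ‖l.F x - y‖ ^ ((p - 1) / (q - 1)) := rfl
  have hTn : ‖T‖ ≤ ‖l.F x - y‖ ^ (p - 1) * l.Lhat := by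
    refine (ContinuousLinearMap.opNorm_comp_le _ _).trans ?_
    rw [(hj _).2]
    gcongr
    exact h.regular.deriv_bound x (h.mem_of_bregman_le hx hxd')
  have hr : 0 < ‖l.F x - y‖ := lt_of_le_of_lt (by positivity) hxr
  set r := ‖l.F x - y‖
  set u := -l.Ctilde p Cp * r ^ 2 + (1 - 2 * l.Ctilde p Cp * l.eta y) * r - l.eta y -
    l.Ctilde p Cp * l.eta y ^ 2
  have hδu : δ ≤ u := by
    refine le_trans (le_of_eq ?_) hu
    rw [hδ, radiusBase]
    ring
  have hu0 : 0 < u := hδ0.trans_le hδu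
  -- `T = 0` would contradict the strictly negative bound `hT`.
  have hT0 : 0 < ‖T‖ := by
    rw [norm_pos_iff]
    rintro h0
    rw [h0, zero_apply] at hT
    have : 0 < u * r ^ (p - 1) := by positivity
    linarith
  have ht : 0 < Gq * ‖T‖ ^ q := by positivity
  have key := stepSize_decrease hpq ht hu0.le hr.le
  rw [← hμ] at key
  have hμ0 : 0 ≤ l.stepSize p q Cp Gq j y x := by rw [hμ]; positivity
  have hlow := decrease_lower_bound hpq hG hL ht hr (by gcongr) hδ0.le hδu
  set μ := l.stepSize p q Cp Gq j y x
  rw [norm_smul, Real.norm_of_nonneg hμ0, Real.mul_rpow hμ0 hT0.le, smul_apply, smul_eq_mul]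
  have h5 := mul_le_mul_of_nonneg_left hT hμ0
  have h6 := mul_le_mul_of_nonneg_left hlow hpq.one_div_nonneg
  have e : Gq / q * (μ ^ q * ‖T‖ ^ q) = 1 / q * (Gq * ‖T‖ ^ q) * μ ^ q := by ring
  rw [e]
  linarith

/-- From an admissible starting point the iteration on one level terminates, and its result is
still within the convergence radius. -/
lemma exists_isRun (h : l.Admissible p q Cp Gq y z B) [CompleteSpace X] {j : Y → StrongDual ℝ Y}
    (hj : ∀ w, j w ∈ dualitySet p w) (hη : 0 < l.eta y) {ε : ℝ} (hε : 0 < ε) {x₀ : X}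
    (hx₀ : x₀ ∈ l.Z) (hd : bregman p x₀ z < l.radius p Cp y) :
    ∃ (x : ℕ → X) (K : ℕ), x 0 = x₀ ∧
      l.IsRun p q Cp Gq j y z ((3 + ε) * l.eta y) x K ∧ x K ∈ l.Z ∧
        bregman p (x K) z < l.radius p Cp y := by
  -- Taking `d` to be the initial distance makes one `κ` serve the whole run, as distances never
  -- exceed `d`.
  obtain ⟨κ, hκ, hstep⟩ :=
    h.exists_step_decrease hj hη hε (bregman_nonneg h.holder x₀ z) hd
  set x : ℕ → X := fun k => (l.step p q Cp Gq j y)^[k] x₀ with hx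
  have hsucc : ∀ k, x (k + 1) = l.step p q Cp Gq j y (x k) := fun k =>
    Function.iterate_succ_apply' _ _ _
  have hinv : ∀ k, (∀ i < k, (3 + ε) * l.eta y < ‖l.F (x i) - y‖) →
      x k ∈ l.Z ∧ bregman p (x k) z ≤ bregman p x₀ z - k * κ := by
    intro k
    induction k with
    | zero => intro _; simpa [hx] using hx₀
    | succ k ih =>
      intro hk
      obtain ⟨h1, h2⟩ := ih fun i hi => hk i (by omega)
      have h3 : 0 ≤ k * κ := by positivity
      obtain ⟨h4, h5⟩ := hstep (x k) h1 (by linarith) (hk k (by omega))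
      rw [hsucc]
      refine ⟨h4, ?_⟩
      push_cast
      linarith
  have hex : ∃ k, ‖l.F (x k) - y‖ ≤ (3 + ε) * l.eta y := by
    by_contra! hcon
    obtain ⟨k, hk⟩ := exists_nat_gt (bregman p x₀ z / κ)
    rw [div_lt_iff₀ hκ] at hk
    have h1 := (hinv k fun i _ => hcon i).2
    have h2 := bregman_nonneg h.holder (x k) z
    linarith
  classical
  obtain ⟨h1, h2⟩ := hinv (Nat.find hex) fun i hi => not_le.1 (Nat.find_min hex hi)
  have h3 : 0 ≤ (Nat.find hex : ℝ) * κ := by positivity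
  exact ⟨x, Nat.find hex, rfl, ⟨hx₀, hd, fun k _ => hsucc k,
    ⟨Nat.find_spec hex, fun k hk => Nat.find_min' hex hk⟩⟩, h1, by linarith⟩

/-- A point of sufficiently small discrepancy is within the convergence radius. -/
lemma bregman_lt_radius (h : l.Admissible p q Cp Gq y z B)
    {x : X} (hx : x ∈ B ∩ l.Z) {τ : ℝ} (hτ : ‖l.F x - y‖ ≤ τ)
    (hcouple : τ < (Cp / p) ^ (1 / p) * (l.Lhat * l.C)⁻¹ * l.radiusBase p Cp y - l.eta y) :
    bregman p x z < l.radius p Cp y := by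
  have hp := h.holder.pos
  have hL := h.regular.Lhat_pos
  have hC := h.regular.C_pos
  have hb := h.radiusBase_pos
  have hc : 0 < Cp / p := div_pos h.convexityConst.1 hp
  have h1 : ‖l.F x - l.F z‖ ≤ ‖l.F x - y‖ + l.eta y := h.norm_image_sub_best_le x
  calc bregman p x z ≤ l.C ^ p * ‖l.F x - l.F z‖ ^ p := h.regular.stability x hx z h.best_mem
    _ < l.C ^ p * ((Cp / p) ^ (1 / p) * (l.Lhat * l.C)⁻¹ * l.radiusBase p Cp y) ^ p := by
      gcongr
      linarith
    _ = l.radius p Cp y := by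
      rw [radius, Real.mul_rpow (by positivity) hb.le,
        Real.mul_rpow (by positivity) (by positivity), ← Real.rpow_mul hc.le,
        one_div_mul_cancel hp.ne', Real.rpow_one, Real.inv_rpow (by positivity),
        Real.mul_rpow hL.le hC.le, Real.rpow_neg hL.le]
      field_simp

end Admissible

end Level

/-! ### Passage between levels. -/

/-- Runs on successive levels can be concatenated. -/
lemma exists_isMultiLevelRun {X Y : Type*} [NormedAddCommGroup X] [NormedSpace ℝ X]
    [NormedAddCommGroup Y] [NormedSpace ℝ Y] {l : ℕ → Level X Y} {p q Cp Gq : ℝ}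
    {j : Y → StrongDual ℝ Y} {y : Y} {z : ℕ → X} {ε : ℝ} {N : ℕ} {x₀ : X} {A : ℕ → Set X}
    (hrun : ∀ n ≤ N, ∀ a ∈ A n, ∃ (x : ℕ → X) (K : ℕ), x 0 = a ∧
      (l n).IsRun p q Cp Gq j y (z n) ((3 + ε) * (l n).eta y) x K ∧ x K ∈ A (n + 1))
    (hx₀ : x₀ ∈ A 0) :
    ∃ (x : ℕ → ℕ → X) (K : ℕ → ℕ), IsMultiLevelRun l p q Cp Gq j y z ε N x₀ x K := by
  suffices H : ∀ n ≤ N, ∃ (x : ℕ → ℕ → X) (K : ℕ → ℕ),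
      IsMultiLevelRun l p q Cp Gq j y z ε n x₀ x K ∧ x n (K n) ∈ A (n + 1) by
    obtain ⟨x, K, h, -⟩ := H N le_rfl
    exact ⟨x, K, h⟩
  intro n
  induction n with
  | zero =>
    intro hn
    obtain ⟨x, K, h0, h1, h2⟩ := hrun 0 hn x₀ hx₀
    exact ⟨fun _ => x, fun _ => K,
      ⟨h0, fun n hn => by obtain rfl : n = 0 := by omega
                          exact h1, fun n hn => by omega⟩, h2⟩
  | succ n ih =>
    intro hn
    obtain ⟨x, K, h, hA⟩ := ih (by omega)
    obtain ⟨x', K', h0, h1, h2⟩ := hrun (n + 1) hn _ hA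
    refine ⟨Function.update x (n + 1) x', Function.update K (n + 1) K', ⟨?_, ?_, ?_⟩, ?_⟩
    · simpa using h.start
    · intro m hm
      rcases eq_or_ne m (n + 1) with rfl | hne
      · simpa using h1
      · simpa [Function.update_of_ne hne] using h.level_run m (by omega)
    · intro m hm
      rcases eq_or_ne m n with rfl | hne
      · simpa using h0
      · have h3 : m + 1 ≠ n + 1 := by omega
        have h4 : m ≠ n + 1 := by omega
        simpa [Function.update_of_ne h3, Function.update_of_ne h4] using
          h.next_start m (by omega)
    · simpa using h2

end MultiLevel

end

theorem mainTheorem2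
    {X Y : Type*} [NormedAddCommGroup X] [NormedSpace ℝ X] [CompleteSpace X]
    [NormedAddCommGroup Y] [NormedSpace ℝ Y] [CompleteSpace Y]
    (p q : ℝ) (hpq : p.HolderConjugate q)
    (hX_convex : MultiLevel.IsPConvex X p) (hX_smooth : MultiLevel.IsQSmooth X q)
    (Cp Gq : ℝ) (hCp : MultiLevel.IsConvexityConst X p Cp)
    (hGq : MultiLevel.IsDualSmoothnessConst X q Gq)
    (j : Y → StrongDual ℝ Y) (hj : ∀ w, j w ∈ MultiLevel.dualitySet p w)
    (y : Y) (l : ℕ → MultiLevel.Level X Y) (z : ℕ → X) (B : Set X)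
    (ε etahat : ℝ) (hε : 0 < ε) (N : ℕ) (x₀ : X)
    -- the assumptions on the levels, on a common set `B` that contains the level balls
    (hreg : ∀ n ≤ N, (l n).Regular p B)
    (hz : ∀ n ≤ N, (l n).IsBestApprox y (z n))
    (hB : ∀ n ≤ N,
      {x | MultiLevel.bregman p x (z n) ≤ (l n).radius p Cp y} ∩ (l n).Z ⊆ B)
    (hη_pos : 0 < (l N).eta y)
    (hη_small : ∀ n ≤ N, 8 * (l n).Ctilde p Cp * (l n).eta y ≤ 1)
    -- nested levels
    (hZ_mono : ∀ n < N, (l n).Z ⊆ (l (n + 1)).Z)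
    (hC_mono : ∀ n < N, (l n).C ≤ (l (n + 1)).C)
    (hη_anti : ∀ n < N, (l (n + 1)).eta y ≤ (l n).eta y)
    -- automatic if the operators of the levels are restrictions of a single operator
    (hF : ∀ n < N, ∀ x ∈ B ∩ (l n).Z, ‖(l (n + 1)).F x - y‖ ≤ ‖(l n).F x - y‖)
    -- the starting point is within the first convergence radius
    (hx₀_mem : x₀ ∈ (l 0).Z)
    (hx₀ : MultiLevel.bregman p x₀ (z 0) < (l 0).radius p Cp y)
    -- coupling of neighbouring levels
    (hcouple : ∀ n < N, (3 + ε) * (l n).eta y <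
      (Cp / p) ^ (1 / p) * ((l (n + 1)).Lhat * (l (n + 1)).C)⁻¹ *
        (l (n + 1)).radiusBase p Cp y - (l (n + 1)).eta y)
    -- `N` is the first level of the desired accuracy
    (hN_first : ∀ n < N, etahat < (3 + ε) * (l n).eta y)
    (hN : (3 + ε) * (l N).eta y ≤ etahat) :
    ∃ (x : ℕ → ℕ → X) (K : ℕ → ℕ),
      MultiLevel.IsMultiLevelRun l p q Cp Gq j y z ε N x₀ x K ∧
        ‖(l N).F (x N (K N)) - y‖ ≤ etahat := by
  have hadm : ∀ n ≤ N, (l n).Admissible p q Cp Gq y (z n) B := fun n hn =>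
    ⟨hpq, hX_smooth, hCp, hGq, hreg n hn, hz n hn, hB n hn, hη_small n hn⟩
  -- Positivity at the last level propagates down, as the errors decrease in `n`.
  have hη : ∀ n ≤ N, 0 < (l n).eta y := fun n hn => by
    induction hn using Nat.decreasingInduction with
    | self => exact hη_pos
    | @of_succ n hn ih => exact ih.trans_le (hη_anti n hn)
  -- past the last level nothing is required of the iterates
  obtain ⟨x, K, h⟩ := MultiLevel.exists_isMultiLevelRun (l := l) (p := p) (q := q) (Cp := Cp)
    (Gq := Gq) (j := j) (y := y) (z := z) (ε := ε) (N := N) (x₀ := x₀)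
    (A := fun n => {a | n ≤ N → a ∈ (l n).Z ∧
      MultiLevel.bregman p a (z n) < (l n).radius p Cp y})
    (fun n hn a ha => by
      obtain ⟨x, K, h0, hrun, hZ, hd⟩ :=
        (hadm n hn).exists_isRun hj (hη n hn) hε (ha hn).1 (ha hn).2
      refine ⟨x, K, h0, hrun, fun hn' => ?_⟩
      have hlt : n < N := hn'
      -- The level-`n` ball puts the final iterate in the common set `B`, so stability on level `n +
      -- 1` applies to it.
      have hmem := (hadm n hn).mem_of_bregman_le hZ hd.le
      have hmem' : x K ∈ B ∩ (l (n + 1)).Z := ⟨hmem.1, hZ_mono n hlt hmem.2⟩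
      exact ⟨hmem'.2, (hadm (n + 1) hn').bregman_lt_radius hmem'
        ((hF n hlt _ hmem).trans hrun.isLeast_index.1) (hcouple n hlt)⟩)
    (fun _ => ⟨hx₀_mem, hx₀⟩)
  exact ⟨x, K, h, (h.level_run N le_rfl).isLeast_index.1.trans hN⟩
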